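/- For $n\ge 0$ let $UD_n$ (resp. $DU_n$) be the set of permutations $\pi=\pi_1\cdots\pi_n$ of $\{1,\dots,n\}$ with $\pi_1<\pi_2>\pi_3<\pi_4>\cdots$ (resp. $\pi_1>\pi_2<\pi_3>\pi_4<\cdots$). For $a,b,c,d\in\{0,1,2,\dots\}$, the entry $\pi_i$ matches the quadrant marked mesh pattern $\mathrm{MMP}(a,b,c,d)$ in $\pi$ if, relative to the point $(i,\pi_i)$, there are at least $a$, $b$, $c$, $d$ points of $\{(j,\pi_j):1\le j\le n\}$ in the open quadrants I, II, III, IV, respectively; $\mathrm{mmp}^{(a,b,c,d)}(\pi)$ is the number of $i$ such that $\pi_i$ matches it. Thus $\mathrm{mmp}^{(0,1,0,0)}(\pi)$ and $\mathrm{mmp}^{(1,0,0,0)}(\pi)$ count the entries of $\pi$ that are not left-to-right maxima and not right-to-left maxima, respectively. Write $w(\pi)=p^{\mathrm{mmp}^{(0,1,0,0)}(\pi)}q^{\mathrm{mmp}^{(1,0,0,0)}(\pi)}$ and $$A(t,p,q)=1+\sum_{n\ge1}\frac{t^{2n}}{(2n)!}\sum_{\pi\in UD_{2n}}w(\pi),\qquad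 B(t,p,q)=\sum_{n\ge1}\frac{t^{2n-1}}{(2n-1)!}\sum_{\pi\in UD_{2n-1}}w(\pi),$$ $$C(t,p,q)=1+\sum_{n\ge1}\frac{t^{2n}}{(2n)!}\sum_{\pi\in DU_{2n}}w(\pi),\qquad D(t,p,q)=\sum_{n\ge1}\frac{t^{2n-1}}{(2n-1)!}\sum_{\pi\in DU_{2n-1}}w(\pi).$$ **Theorem.** Let $p,q$ be nonzero real numbers and let $t$ be a real number with $|pqt|<\pi/2$. Then the four series converge absolutely, and $$A(t,p,q)=1+\int_0^t\left[(\sec(pqs))^{\frac1p+\frac1q}\int_0^{qs}(\sec(pz))^{-\frac1p}\,dz\right]ds,$$ $$B(t,p,q)=t+\int_0^t\left[(\sec(pqs))^{\frac1p+\frac1q}\int_0^{qs}(\sec(pz))^{-\frac1p}\,dz\int_0^{ps}(\sec(qz))^{-\frac1q}\,dz\right]ds,$$ $$C(t,p,q)=1+\int_0^t\left[(\sec(pqs))^{\frac1p+\frac1q}\int_0^{ps}(\sec(qz))^{-\frac1q}\,dz\right]ds,$$ $$D(t,p,q)=\int_0^t(\sec(pqz))^{\frac1p+\frac1q}\,dz.$$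 -/

import Mathlib

namespace AltPerm

/-- `π = π₁ ⋯ πₙ` is up-down: `π₁ < π₂ > π₃ < ⋯`.  Positions are counted from `0` here, so the
ascents sit at the even positions. -/
def IsUpDown {n : ℕ} (π : Equiv.Perm (Fin n)) : Prop :=
  ∀ i j : Fin n, (j : ℕ) = (i : ℕ) + 1 →
    (Even (i : ℕ) → π i < π j) ∧ (Odd (i : ℕ) → π j < π i)

/-- `π = π₁ ⋯ πₙ` is down-up: `π₁ > π₂ < π₃ > ⋯`. -/
def IsDownUp {n : ℕ} (π : Equiv.Perm (Fin n)) : Prop :=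
  ∀ i j : Fin n, (j : ℕ) = (i : ℕ) + 1 →
    (Even (i : ℕ) → π j < π i) ∧ (Odd (i : ℕ) → π i < π j)

instance {n : ℕ} : DecidablePred (IsUpDown (n := n)) := fun π => by
  unfold IsUpDown; infer_instance

instance {n : ℕ} : DecidablePred (IsDownUp (n := n)) := fun π => by
  unfold IsDownUp; infer_instance

/-- The set of up-down permutations of length `n`. -/
def UD (n : ℕ) : Finset (Equiv.Perm (Fin n)) := Finset.univ.filter IsUpDown

/-- The set of down-up permutations of length `n`. -/
def DU (n : ℕ) : Finset (Equiv.Perm (Fin n)) := Finset.univ.filter IsDownUp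

/-- The point `(i, π i)` of the graph of `π` matches the quadrant marked mesh pattern
`MMP(a,b,c,d)`: relative to that point, there are at least `a`, `b`, `c`, `d` points of the graph
in quadrant I (right, above), II (left, above), III (left, below), IV (right, below). -/
def MatchesMMP (a b c d : ℕ) {n : ℕ} (π : Equiv.Perm (Fin n)) (i : Fin n) : Prop :=
  a ≤ (Finset.univ.filter fun j : Fin n => i < j ∧ π i < π j).card ∧
  b ≤ (Finset.univ.filter fun j : Fin n => j < i ∧ π i < π j).card ∧
  c ≤ (Finset.univ.filter fun j : Fin n => j < i ∧ π j < π i).card ∧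
  d ≤ (Finset.univ.filter fun j : Fin n => i < j ∧ π j < π i).card

instance (a b c d : ℕ) {n : ℕ} (π : Equiv.Perm (Fin n)) :
    DecidablePred (MatchesMMP a b c d π) := fun i => by
  unfold MatchesMMP; infer_instance

/-- The number of occurrences of `MMP(a,b,c,d)` in `π`. -/
def mmp (a b c d : ℕ) {n : ℕ} (π : Equiv.Perm (Fin n)) : ℕ :=
  (Finset.univ.filter fun i : Fin n => MatchesMMP a b c d π i).card

/-- The joint distribution polynomial of `(MMP(0,1,0,0), MMP(1,0,0,0))` over a finite set `S` of
permutations of length `n`, evaluated at `(p, q)`. -/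
def jointPoly {n : ℕ} (S : Finset (Equiv.Perm (Fin n))) (p q : ℝ) : ℝ :=
  ∑ π ∈ S, p ^ mmp 0 1 0 0 π * q ^ mmp 1 0 0 0 π

/-- The term of index `m` of an exponential generating function in `t`, whose coefficient is the
joint distribution polynomial over the set `S m` of permutations of length `m`. -/
noncomputable def egfTerm (S : (m : ℕ) → Finset (Equiv.Perm (Fin m))) (t p q : ℝ) (m : ℕ) : ℝ :=
  jointPoly (S m) p q * t ^ m / (m.factorial : ℝ)

/-- `A(t,p,q) = 1 + ∑_{n ≥ 1} A_{2n}(p,q) t^{2n}/(2n)!`, the sum over `UD_{2n}`. -/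
noncomputable def genA (t p q : ℝ) : ℝ := 1 + ∑' n : ℕ, egfTerm UD t p q (2 * (n + 1))

/-- `B(t,p,q) = ∑_{n ≥ 0} B_{2n+1}(p,q) t^{2n+1}/(2n+1)!`, the sum over `UD_{2n+1}`. -/
noncomputable def genB (t p q : ℝ) : ℝ := ∑' n : ℕ, egfTerm UD t p q (2 * n + 1)

/-- `C(t,p,q) = 1 + ∑_{n ≥ 1} C_{2n}(p,q) t^{2n}/(2n)!`, the sum over `DU_{2n}`. -/
noncomputable def genC (t p q : ℝ) : ℝ := 1 + ∑' n : ℕ, egfTerm DU t p q (2 * (n + 1))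

/-- `D(t,p,q) = ∑_{n ≥ 0} D_{2n+1}(p,q) t^{2n+1}/(2n+1)!`, the sum over `DU_{2n+1}`. -/
noncomputable def genD (t p q : ℝ) : ℝ := ∑' n : ℕ, egfTerm DU t p q (2 * n + 1)

/-- The secant. -/
noncomputable def sec (x : ℝ) : ℝ := 1 / Real.cos x

end AltPerm

/-!
Remove the largest letter of an alternating permutation. What remains is an alternating word on its
left and an up-down word on its right, on complementary sets of letters. No letter on the left is a
right-to-left maximum of the whole permutation and no letter on the right is a left-to-right maximum,
so that each letter on the left carries a factor `q` and each one on the right a factor `p`, and what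
is left to record is the number of left-to-right maxima on the left and the number of right-to-left
maxima on the right (`altSum_insert`, `altCoeff_succ`). For the exponential generating functions this
says that the derivative of the one with parameters `p, q` is, up to the constant `1` for the
up-down permutation of length one, the product `L (q t) * R (p t)` of generating functions in which
one of the parameters is `1` (`derivative_altSeries`).

For these special parameters the equation can be solved. With `p = q = 1` it is
`y' = 1 + y²`, solved by the tangent; with only one parameter equal to `1` it is the linear equation
`y' = y tan (p x)` or `y' = 1 + y tan (p x)`, solved by `secPow` and `secPowIntegral`. Integrating the
product once more gives the four formulas.

Convergence comes from the solutions and not from estimates of the coefficients: the tangent and the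
powers of the cosine are holomorphic on the disc of radius `π / 2`, so they are sums of power series on
the interval `|x| < π / 2` (`HasSeries.exists_of_differentiableOn`), a property that passes to products
and antiderivatives. As a formal linear differential equation has only one solution with given constant
term, the generating functions are these power series (`HasSeries.of_derivative_eq`).
-/

open Finset

namespace AltPerm

/-! ### Words and their statistics -/

/-- The word `l` is alternating. The flag says whether its first step is an ascent (`true`) or a
descent (`false`). -/
def IsAlt {α : Type} [LinearOrder α] : Bool → List α → Prop
  | _, [] => True
  | b, x :: l => (∀ y ∈ l.head?, if b then x < y else y < x) ∧ IsAlt (!b) l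

/-- The number of letters of a word that have a larger letter to their right, that is, that are not
right-to-left maxima. The number of letters that are not left-to-right maxima is
`nonRLMax l.reverse`. -/
def nonRLMax {α : Type} [LinearOrder α] : List α → ℕ
  | [] => 0
  | x :: l => (if ∃ y ∈ l, x < y then 1 else 0) + nonRLMax l

section Words

variable {α : Type} [LinearOrder α]

/-- A letter `M` larger than all others makes an alternating word split into two. If `M` has a
neighbour, it has to be a peak, which fixes the parity of its position; after a peak the word goes on
with an ascent. -/
theorem isAlt_append_cons (b : Bool) (M : α) (l₁ l₂ : List α) (h₁ : ∀ x ∈ l₁, x < M)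
    (h₂ : ∀ x ∈ l₂, x < M) :
    IsAlt b (l₁ ++ M :: l₂) ↔
      IsAlt b l₁ ∧ IsAlt true l₂ ∧ (l₁.length.bodd = b ∨ (l₁ = [] ∧ l₂ = [])) := by
  induction l₁ generalizing b with
  | nil =>
    cases l₂ with
    | nil => simp [IsAlt]
    | cons y l₂ =>
      have hy : y < M := h₂ y (by simp)
      cases b <;> simp [IsAlt, hy, hy.le]
  | cons x l₁ ih =>
    have hx : x < M := h₁ x (by simp)
    have ih' := ih (!b) fun y hy => h₁ y (by simp [hy])
    cases l₁ with
    | nil => cases b <;> cases l₂ <;> simp_all [IsAlt, le_of_lt]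
    | cons y l₁ =>
      rw [List.cons_append, IsAlt, ih', IsAlt.eq_2 b x (y :: l₁)]
      have hb : ((y :: l₁).length.bodd = !b) ↔ ((x :: y :: l₁).length.bodd = b) := by
        simp only [List.length_cons, Nat.bodd_succ]
        cases b <;> simp
      rw [hb]
      simp [and_assoc]

theorem nonRLMax_append_cons (M : α) (l₁ l₂ : List α) (h₁ : ∀ x ∈ l₁, x < M)
    (h₂ : ∀ x ∈ l₂, x < M) :
    nonRLMax (l₁ ++ M :: l₂) = l₁.length + nonRLMax l₂ := by
  induction l₁ with
  | nil =>
    have : ¬ ∃ y ∈ l₂, M < y := fun ⟨y, hy, h⟩ => (h₂ y hy).not_gt h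
    simp [nonRLMax, this]
  | cons x l₁ ih =>
    have hx : ∃ y ∈ l₁ ++ M :: l₂, x < y := ⟨M, by simp, h₁ x (by simp)⟩
    rw [List.cons_append, nonRLMax, if_pos hx, ih fun y hy => h₁ y (by simp [hy])]
    simp; ring

theorem nonRLMax_reverse_append_cons (M : α) (l₁ l₂ : List α) (h₁ : ∀ x ∈ l₁, x < M)
    (h₂ : ∀ x ∈ l₂, x < M) :
    nonRLMax (l₁ ++ M :: l₂).reverse = nonRLMax l₁.reverse + l₂.length := by
  have := nonRLMax_append_cons M l₂.reverse l₁.reverse (by simpa using h₂) (by simpa using h₁)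
  simp only [List.reverse_append, List.reverse_cons, List.append_assoc, List.singleton_append]
  rw [this, List.length_reverse, add_comm]

theorem isAlt_ofFn (b : Bool) {n : ℕ} (f : Fin n → α) :
    IsAlt b (List.ofFn f) ↔ ∀ i j : Fin n, (j : ℕ) = i + 1 →
      if (i : ℕ).bodd = b then f j < f i else f i < f j := by
  induction n generalizing b with
  | zero => simp [IsAlt]
  | succ n ih =>
    rw [List.ofFn_succ, IsAlt, ih]
    constructor
    · rintro ⟨h0, h⟩ i j hij
      obtain ⟨j, rfl⟩ := Fin.exists_succ_eq.2 (show j ≠ 0 by rintro rfl; simp at hij)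
      induction i using Fin.cases with
      | zero =>
        obtain ⟨m, rfl⟩ : ∃ m, n = m + 1 := ⟨n - 1, by have := j.2; omega⟩
        obtain rfl : j = 0 := by ext; simpa using hij
        have := h0 (f (Fin.succ 0)) (by simp)
        cases b <;> simpa using this
      | succ i =>
        have := h i j (by simpa using hij)
        simp only [Fin.val_succ, Nat.bodd_succ] at this ⊢
        cases b <;> cases hi : (i : ℕ).bodd <;> simp_all
    · intro h
      refine ⟨fun y hy => ?_, fun i j hij => ?_⟩
      · cases n with
        | zero => simp at hy
        | succ n =>
          obtain rfl : f (Fin.succ 0) = y := by simpa using hy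
          have := h 0 (Fin.succ 0) (by simp)
          cases b <;> simpa using this
      · have := h i.succ j.succ (by simpa using hij)
        simp only [Fin.val_succ, Nat.bodd_succ] at this ⊢
        cases b <;> cases hi : (i : ℕ).bodd <;> simp_all

theorem card_exists_gt_right {n : ℕ} (f : Fin n → α) :
    #{i | ∃ j, i < j ∧ f i < f j} = nonRLMax (List.ofFn f) := by
  induction n with
  | zero => simp [nonRLMax]
  | succ n ih =>
    rw [List.ofFn_succ, nonRLMax, ← ih, Fin.card_filter_univ_succ]
    simp [Fin.exists_fin_succ, add_comm, List.mem_ofFn]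
    split_ifs <;> ring

theorem card_exists_gt_left {n : ℕ} (f : Fin n → α) :
    #{i | ∃ j, j < i ∧ f i < f j} = nonRLMax (List.ofFn f).reverse := by
  induction n with
  | zero => simp [nonRLMax]
  | succ n ih =>
    rw [List.ofFn_succ', List.concat_eq_append, List.reverse_append, List.reverse_singleton,
      List.singleton_append, nonRLMax, ← ih, card_filter, card_filter, Fin.sum_univ_castSucc,
      add_comm]
    simp [Fin.exists_fin_succ', (Fin.castSucc_lt_last _).not_gt]

end Words

theorem mmp_right {n : ℕ} (π : Equiv.Perm (Fin n)) :
    mmp 1 0 0 0 π = nonRLMax (List.ofFn π) := by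
  rw [← card_exists_gt_right]
  simp [mmp, MatchesMMP, Nat.one_le_iff_ne_zero, Finset.filter_eq_empty_iff]

theorem mmp_left {n : ℕ} (π : Equiv.Perm (Fin n)) :
    mmp 0 1 0 0 π = nonRLMax (List.ofFn π).reverse := by
  rw [← card_exists_gt_left]
  simp [mmp, MatchesMMP, Nat.one_le_iff_ne_zero, Finset.filter_eq_empty_iff]

theorem bodd_eq_decide_odd (n : ℕ) : n.bodd = decide (Odd n) := by
  induction n with
  | zero => simp
  | succ n ih =>
    rw [Nat.bodd_succ, ih, ← decide_not]
    exact decide_eq_decide.2 Nat.odd_add_one.symm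

theorem mem_UD_iff {n : ℕ} (π : Equiv.Perm (Fin n)) :
    π ∈ UD n ↔ IsAlt true (List.ofFn π) := by
  rw [isAlt_ofFn, UD, mem_filter_univ, IsUpDown]
  refine forall_congr' fun i => forall_congr' fun j => imp_congr_right fun _ => ?_
  rcases Nat.even_or_odd (i : ℕ) with h | h
  · simp [bodd_eq_decide_odd, h]
  · simp [bodd_eq_decide_odd, h]

theorem mem_DU_iff {n : ℕ} (π : Equiv.Perm (Fin n)) :
    π ∈ DU n ↔ IsAlt false (List.ofFn π) := by
  rw [isAlt_ofFn, DU, mem_filter_univ, IsDownUp]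
  refine forall_congr' fun i => forall_congr' fun j => imp_congr_right fun _ => ?_
  rcases Nat.even_or_odd (i : ℕ) with h | h
  · simp [bodd_eq_decide_odd, h]
  · simp [bodd_eq_decide_odd, h]

/-! ### Removing the largest letter -/

/-- The words in which every element of `S` occurs exactly once, and nothing else occurs. -/
def words {α : Type} (S : Finset α) : Finset (List α) :=
  ⟨S.val.lists, Multiset.lists_nodup_finset S⟩

open Classical in
/-- The sum of `p ^ (number of letters that are not left-to-right maxima) *
q ^ (number of letters that are not right-to-left maxima)` over the alternating words on `S` whose
first step is given by `b`. -/
noncomputable def altSum {α : Type} [LinearOrder α] (b : Bool) (S : Finset α) (p q : ℝ) : ℝ :=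
  ∑ l ∈ words S with IsAlt b l, p ^ nonRLMax l.reverse * q ^ nonRLMax l

section Recurrence

variable {α : Type} [LinearOrder α]

theorem mem_words {S : Finset α} {l : List α} : l ∈ words S ↔ l.Nodup ∧ l.toFinset = S := by
  have : l ∈ words S ↔ S.val = (l : Multiset α) := by
    rw [← Finset.mem_val]; exact Multiset.mem_lists_iff _ _
  rw [this]
  constructor
  · intro h
    have hn : l.Nodup := by rw [← Multiset.coe_nodup, ← h]; exact S.nodup
    exact ⟨hn, by ext x; rw [List.mem_toFinset, ← Multiset.mem_coe, ← h, Finset.mem_val]⟩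
  · rintro ⟨hn, rfl⟩
    rw [List.toFinset_val, hn.dedup]

theorem mem_of_mem_words {S : Finset α} {l : List α} (hl : l ∈ words S) {x : α} :
    x ∈ l ↔ x ∈ S := by
  rw [← (mem_words.1 hl).2, List.mem_toFinset]

theorem length_of_mem_words {S : Finset α} {l : List α} (hl : l ∈ words S) : l.length = #S := by
  rw [← (mem_words.1 hl).2, List.toFinset_card_of_nodup (mem_words.1 hl).1]

theorem words_empty : words (∅ : Finset α) = {[]} := by
  ext l
  simp only [mem_words, List.toFinset_eq_empty_iff, mem_singleton]
  exact ⟨fun h => h.2, by rintro rfl; simp⟩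

/-- A word that contains `M` once is the same as a distribution of the other letters to the two sides
of `M` together with a word on each side. -/
theorem sum_words_insert {S : Finset α} {M : α} (hM : M ∉ S) (f : List α → ℝ) :
    ∑ l ∈ words (insert M S), f l =
      ∑ T ∈ S.powerset, ∑ l₁ ∈ words T, ∑ l₂ ∈ words (S \ T), f (l₁ ++ M :: l₂) := by
  simp_rw [← sum_product', sum_sigma']
  symm
  refine sum_bij (fun x _ => x.2.1 ++ M :: x.2.2) ?_ ?_ ?_ (fun _ _ => rfl)
  · rintro ⟨T, l₁, l₂⟩ h
    simp only [mem_sigma, mem_powerset, mem_product] at h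
    obtain ⟨hT, h₁, h₂⟩ := h
    rw [mem_words]
    constructor
    · rw [List.nodup_append, List.nodup_cons]
      refine ⟨(mem_words.1 h₁).1, ⟨?_, (mem_words.1 h₂).1⟩, ?_⟩
      · rw [mem_of_mem_words h₂]; simp [hM]
      · intro a ha b hb
        rw [mem_of_mem_words h₁] at ha
        rw [List.mem_cons, mem_of_mem_words h₂, mem_sdiff] at hb
        rintro rfl
        rcases hb with rfl | hb
        · exact hM (hT ha)
        · exact hb.2 ha
    · ext x
      simp only [List.mem_toFinset, List.mem_append, List.mem_cons, mem_of_mem_words h₁,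
        mem_of_mem_words h₂, mem_insert, mem_sdiff]
      have := @hT x
      tauto
  · rintro ⟨T, l₁, l₂⟩ h ⟨T', l₁', l₂'⟩ h' e
    simp only [mem_sigma, mem_powerset, mem_product] at h h'
    obtain ⟨hT, h₁, h₂⟩ := h
    obtain ⟨hT', h₁', h₂'⟩ := h'
    have hx : M ∉ l₁ := by rw [mem_of_mem_words h₁]; exact fun h => hM (hT h)
    have hy : M ∉ l₂ := by rw [mem_of_mem_words h₂]; simp [hM]
    obtain ⟨rfl, -, rfl⟩ := (List.append_cons_inj_of_notMem hx hy).1 e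
    obtain rfl : T = T' := by rw [← (mem_words.1 h₁).2, ← (mem_words.1 h₁').2]
    rfl
  · intro l hl
    obtain ⟨hn, hS⟩ := mem_words.1 hl
    have hMl : M ∈ l := by rw [mem_of_mem_words hl]; simp
    obtain ⟨l₁, l₂, rfl⟩ := List.append_of_mem hMl
    rw [List.nodup_append, List.nodup_cons] at hn
    obtain ⟨hn₁, ⟨hMl₂, hn₂⟩, hd⟩ := hn
    have hMl₁ : M ∉ l₁ := fun h => hd M h M (by simp) rfl
    have hx : ∀ x, x ∈ S ↔ x ∈ l₁ ∨ x ∈ l₂ := by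
      intro x
      have := mem_of_mem_words hl (x := x)
      simp only [List.mem_append, List.mem_cons, mem_insert] at this
      by_cases hxM : x = M
      · subst hxM; simp [hM, hMl₁, hMl₂]
      · simpa [hxM] using this.symm
    refine ⟨⟨l₁.toFinset, l₁, l₂⟩, ?_, rfl⟩
    simp only [mem_sigma, mem_powerset, mem_product, mem_words, hn₁, hn₂, true_and]
    refine ⟨fun x h => (hx x).2 (Or.inl (by simpa using h)), ?_⟩
    ext x
    rw [mem_sdiff, hx, List.mem_toFinset, List.mem_toFinset]
    have := fun h => hd x h x
    simp only [List.mem_cons, not_true_eq_false, ne_eq, imp_false, not_or] at this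
    tauto

/-- The largest letter `M` splits an alternating word into an alternating word on its left and an
up-down word on its right, and, unless it is the only letter, it has to stand at a peak. No letter on
its left is a right-to-left maximum and no letter on its right is a left-to-right maximum. -/
theorem altSum_insert (b : Bool) {S : Finset α} {M : α} (hM : ∀ x ∈ S, x < M) (p q : ℝ) :
    altSum b (insert M S) p q = (if b ∧ #S = 0 then 1 else 0) +
      ∑ T ∈ S.powerset, if (#T).bodd = b then
        (q ^ #T * altSum b T p 1) * (p ^ (#S - #T) * altSum true (S \ T) 1 q) else 0 := by
  classical
  have hMS : M ∉ S := fun h => (hM M h).false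
  rw [altSum, sum_filter, sum_words_insert hMS]
  rcases S.eq_empty_or_nonempty with rfl | hS
  · cases b <;> simp [words_empty, altSum, sum_filter, IsAlt, nonRLMax]
  -- From here on `M` has a neighbour, so it is a peak.
  have hS0 : #S ≠ 0 := hS.card_pos.ne'
  rw [if_neg fun h => hS0 h.2, zero_add]
  refine sum_congr rfl fun T hT => ?_
  rw [mem_powerset] at hT
  have key : ∀ l₁ ∈ words T, ∀ l₂ ∈ words (S \ T),
      (if IsAlt b (l₁ ++ M :: l₂) then
        p ^ nonRLMax (l₁ ++ M :: l₂).reverse * q ^ nonRLMax (l₁ ++ M :: l₂) else 0) =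
      if (#T).bodd = b then
        (q ^ #T * if IsAlt b l₁ then p ^ nonRLMax l₁.reverse * 1 ^ nonRLMax l₁ else 0) *
        (p ^ (#S - #T) * if IsAlt true l₂ then 1 ^ nonRLMax l₂.reverse * q ^ nonRLMax l₂ else 0)
      else 0 := by
    intro l₁ h₁ l₂ h₂
    have hl₁ : ∀ x ∈ l₁, x < M := fun x hx => hM x (hT ((mem_of_mem_words h₁).1 hx))
    have hl₂ : ∀ x ∈ l₂, x < M := fun x hx =>
      hM x (mem_sdiff.1 ((mem_of_mem_words h₂).1 hx)).1
    have e₁ := length_of_mem_words h₁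
    have e₂ := length_of_mem_words h₂
    rw [card_sdiff_of_subset hT] at e₂
    have hne : ¬ (l₁ = [] ∧ l₂ = []) := by
      rintro ⟨rfl, rfl⟩
      have := card_le_card hT
      simp only [List.length_nil] at e₁ e₂
      omega
    simp only [isAlt_append_cons b M l₁ l₂ hl₁ hl₂, hne, or_false,
      nonRLMax_append_cons M l₁ l₂ hl₁ hl₂, nonRLMax_reverse_append_cons M l₁ l₂ hl₁ hl₂, e₁, e₂,
      one_pow, one_mul, mul_one, pow_add]
    by_cases hb : (#T).bodd = b <;> by_cases ha₁ : IsAlt b l₁ <;> by_cases ha₂ : IsAlt true l₂ <;>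
      simp only [hb, ha₁, ha₂, and_true, and_false, if_true, if_false, mul_zero, zero_mul]
    ring
  rw [sum_congr rfl fun l₁ h₁ => sum_congr rfl fun l₂ h₂ => key l₁ h₁ l₂ h₂]
  split_ifs with h
  · rw [altSum, altSum, sum_filter, sum_filter, mul_sum, mul_sum, sum_mul_sum]
  · simp

end Recurrence

theorem jointPoly_eq_altSum (b : Bool) {n : ℕ} (S : Finset (Equiv.Perm (Fin n)))
    (hS : ∀ π, π ∈ S ↔ IsAlt b (List.ofFn π)) (p q : ℝ) :
    jointPoly S p q = altSum b (univ : Finset (Fin n)) p q := by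
  classical
  rw [jointPoly, altSum]
  refine sum_bij (fun π _ => List.ofFn π) ?_ ?_ ?_ ?_
  · intro π hπ
    rw [mem_filter, mem_words]
    refine ⟨⟨List.nodup_ofFn.2 π.injective, ?_⟩, (hS π).1 hπ⟩
    ext x
    simpa using π.surjective x
  · intro π _ σ _ h
    exact Equiv.coe_fn_injective (List.ofFn_injective h)
  · intro l hl
    rw [mem_filter] at hl
    obtain ⟨hl, ha⟩ := hl
    obtain ⟨hn, hu⟩ := mem_words.1 hl
    have hlen : l.length = n := by rw [length_of_mem_words hl, card_univ, Fintype.card_fin]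
    have hinj : Function.Injective fun i : Fin n => l.get (i.cast hlen.symm) :=
      (List.nodup_iff_injective_get.1 hn).comp (Fin.cast_injective _)
    have hof : List.ofFn (fun i : Fin n => l.get (i.cast hlen.symm)) = l :=
      List.ext_getElem (by simp [hlen]) (by simp)
    refine ⟨Equiv.ofBijective _ (Finite.injective_iff_bijective.1 hinj), ?_, hof⟩
    rw [hS]
    exact hof.symm ▸ ha
  · intro π _
    rw [mmp_left, mmp_right]

/-- The sum over alternating words on `{0, …, n - 1}`. -/
noncomputable def altCoeff (b : Bool) (n : ℕ) (p q : ℝ) : ℝ :=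
  altSum b (univ : Finset (Fin n)) p q

/-- `altSum` depends on the set of letters only through its size. -/
theorem altSum_eq_altCoeff {n : ℕ} {α : Type} [LinearOrder α] (S : Finset α) (hS : #S = n)
    (b : Bool) (p q : ℝ) : altSum b S p q = altCoeff b n p q := by
  induction n using Nat.strong_induction_on generalizing α b p q with
  | _ n ih =>
    rcases S.eq_empty_or_nonempty with rfl | hne
    · obtain rfl : n = 0 := by simpa using hS.symm
      simp [altCoeff, altSum, words_empty, sum_filter, IsAlt, nonRLMax]
    -- The recurrence expresses both sides through the same numbers of smaller index.
    have expand : ∀ {β : Type} [LinearOrder β] (R : Finset β), #R = n → R.Nonempty →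
        altSum b R p q = (if b ∧ n - 1 = 0 then 1 else 0) +
          ∑ k ∈ range (n - 1 + 1), (n - 1).choose k • if k.bodd = b then
            (q ^ k * altCoeff b k p 1) *
              (p ^ (n - 1 - k) * altCoeff true (n - 1 - k) 1 q) else 0 := by
      intro β _ R hR hRne
      have hins : insert (R.max' hRne) (R.erase (R.max' hRne)) = R := insert_erase (max'_mem _ _)
      have hcard : #(R.erase (R.max' hRne)) = n - 1 := by rw [card_erase_of_mem (max'_mem _ _), hR]
      have hn : 0 < n := hR ▸ hRne.card_pos
      have hrec := altSum_insert b (fun x hx => lt_max'_of_mem_erase_max' R hRne hx) p q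
      have hsum := sum_powerset_apply_card (x := R.erase (R.max' hRne)) fun k =>
        if k.bodd = b then (q ^ k * altCoeff b k p 1) *
          (p ^ (n - 1 - k) * altCoeff true (n - 1 - k) 1 q) else 0
      simp only [hcard] at hsum hrec
      rw [← hins, hrec, ← hsum]
      congr 1
      refine sum_congr rfl fun T hT => ?_
      rw [mem_powerset] at hT
      have hle := card_le_card hT
      have hsd := card_sdiff_of_subset hT
      rw [hcard] at hle hsd
      rw [ih #T (by omega) T rfl, ih _ (by omega) _ hsd]
    have hn : 0 < n := hS ▸ hne.card_pos
    rw [altCoeff, expand S hS hne, expand univ (by simp) ⟨⟨0, hn⟩, mem_univ _⟩]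

theorem altCoeff_zero (b : Bool) (p q : ℝ) : altCoeff b 0 p q = 1 := by
  simp [altCoeff, altSum, words_empty, sum_filter, IsAlt, nonRLMax]

theorem altCoeff_succ (b : Bool) (n : ℕ) (p q : ℝ) :
    altCoeff b (n + 1) p q = (if b ∧ n = 0 then 1 else 0) +
      ∑ k ∈ range (n + 1), n.choose k • if k.bodd = b then
        (q ^ k * altCoeff b k p 1) * (p ^ (n - k) * altCoeff true (n - k) 1 q) else 0 := by
  have h : altCoeff b (n + 1) p q = altSum b (insert n (range n)) p q :=
    (altSum_eq_altCoeff _ (by simp) b p q).symm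
  have hsum := sum_powerset_apply_card (x := range n) fun k =>
    if k.bodd = b then (q ^ k * altCoeff b k p 1) *
      (p ^ (n - k) * altCoeff true (n - k) 1 q) else 0
  have hrec := altSum_insert b (S := range n) (M := n) (by simp) p q
  simp only [card_range] at hsum hrec
  rw [h, hrec, ← hsum]
  congr 1
  refine sum_congr rfl fun T hT => ?_
  rw [altSum_eq_altCoeff T rfl, altSum_eq_altCoeff (range n \ T) (by
    rw [card_sdiff_of_subset (mem_powerset.1 hT), card_range])]

/-! ### Formal generating functions -/

/-- The exponential generating function, with coefficients in `ℝ`, of the numbers `altCoeff b n p q`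
over the `n` of one parity: the odd `n` if `e = true`, the even `n` if `e = false`. -/
noncomputable def altSeries (b e : Bool) (p q : ℝ) : PowerSeries ℝ :=
  PowerSeries.mk fun n => if n.bodd = e then altCoeff b n p q / n.factorial else 0

theorem constantCoeff_altSeries (b e : Bool) (p q : ℝ) :
    PowerSeries.constantCoeff (altSeries b e p q) = if e then 0 else 1 := by
  rw [← PowerSeries.coeff_zero_eq_constantCoeff_apply, altSeries, PowerSeries.coeff_mk]
  cases e <;> simp [altCoeff_zero]

/-- The recurrence `altCoeff_succ` as a differential equation: differentiating removes the largest
letter. -/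
theorem derivative_altSeries (b e : Bool) (p q : ℝ) :
    PowerSeries.derivative ℝ (altSeries b e p q) = PowerSeries.C (if b && e then 1 else 0) +
      PowerSeries.rescale q (altSeries b b p 1) *
        PowerSeries.rescale p (altSeries true ((!e) ^^ b) 1 q) := by
  ext n
  rw [PowerSeries.coeff_derivative, map_add, PowerSeries.coeff_mul,
    Finset.Nat.sum_antidiagonal_eq_sum_range_succ_mk, PowerSeries.coeff_C, altSeries,
    PowerSeries.coeff_mk]
  simp only [PowerSeries.coeff_rescale, altSeries, PowerSeries.coeff_mk]
  have hpar : ∀ k ∈ range (n + 1), n.bodd = (k.bodd ^^ (n - k).bodd) := fun k hk => by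
    rw [← Nat.bodd_add, Nat.add_sub_cancel' (by simpa [Nat.lt_succ_iff] using hk)]
  by_cases h : (n + 1).bodd = e
  · have hn : (n + 1 : ℝ) ≠ 0 := by positivity
    have hf : (n.factorial : ℝ) ≠ 0 := by positivity
    rw [if_pos h, altCoeff_succ, Nat.factorial_succ, Nat.cast_mul, Nat.cast_succ, add_div, add_mul,
      sum_div, sum_mul]
    congr 1
    · rcases Nat.eq_zero_or_pos n with rfl | hpos
      · obtain rfl : e = true := by simpa using h.symm
        simp
      · simp [hpos.ne']
    · refine sum_congr rfl fun k hk => ?_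
      have hkn : k ≤ n := by simpa [Nat.lt_succ_iff] using hk
      by_cases hkb : k.bodd = b
      · have hnk : (n - k).bodd = ((!e) ^^ b) := by
          have := hpar k hk
          rw [Nat.bodd_succ] at h
          subst h hkb
          rw [this]
          cases k.bodd <;> simp
        rw [if_pos hkb, if_pos hkb, if_pos hnk, nsmul_eq_mul, Nat.cast_choose ℝ hkn]
        field_simp
      · simp [hkb]
  · rw [if_neg h, zero_mul, sum_eq_zero, add_zero]
    · rcases Nat.eq_zero_or_pos n with rfl | hpos
      · obtain rfl : e = false := by simpa using h
        simp
      · simp [hpos.ne']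
    · intro k hk
      by_cases hkb : k.bodd = b
      · have hnk : (n - k).bodd ≠ ((!e) ^^ b) := by
          intro hnk
          have := hpar k hk
          rw [Nat.bodd_succ] at h
          rw [this, hkb, hnk] at h
          cases b <;> simp at h
        rw [if_neg hnk, mul_zero, mul_zero]
      · rw [if_neg hkb, mul_zero, zero_mul]

/-- A linear differential equation of first order has at most one formal solution with given
constant term. -/
theorem eq_of_derivative_eq {F G T : PowerSeries ℝ} {c : ℝ}
    (hF : PowerSeries.derivative ℝ F = PowerSeries.C c + F * T)
    (hG : PowerSeries.derivative ℝ G = PowerSeries.C c + G * T)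
    (h0 : PowerSeries.constantCoeff F = PowerSeries.constantCoeff G) : F = G := by
  ext n
  induction n using Nat.strong_induction_on with
  | _ n ih =>
    cases n with
    | zero => simpa using h0
    | succ n =>
      have e : PowerSeries.coeff n (PowerSeries.derivative ℝ F) =
          PowerSeries.coeff n (PowerSeries.derivative ℝ G) := by
        rw [hF, hG, map_add, map_add, PowerSeries.coeff_mul, PowerSeries.coeff_mul]
        congr 1
        refine sum_congr rfl fun x hx => ?_
        rw [ih x.1 (by have := mem_antidiagonal.1 hx; omega)]
      rw [PowerSeries.coeff_derivative, PowerSeries.coeff_derivative] at e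
      exact mul_right_cancel₀ (by positivity) e

theorem exists_derivative_eq (G : PowerSeries ℝ) (c : ℝ) :
    ∃ H : PowerSeries ℝ, PowerSeries.derivative ℝ H = G ∧ PowerSeries.constantCoeff H = c := by
  refine ⟨PowerSeries.mk fun n => if n = 0 then c else PowerSeries.coeff (n - 1) G / n, ?_, ?_⟩
  · ext n
    rw [PowerSeries.coeff_derivative, PowerSeries.coeff_mk]
    have : (n : ℝ) + 1 ≠ 0 := by positivity
    simp [this]
  · rw [← PowerSeries.coeff_zero_eq_constantCoeff_apply, PowerSeries.coeff_mk, if_pos rfl]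

/-! ### Functions given by a power series on an interval -/

theorem abs_le_of_mem_uIcc {x t : ℝ} (hx : x ∈ Set.uIcc 0 t) : |x| ≤ |t| := by
  have := Set.abs_sub_left_of_mem_uIcc hx
  simpa using this

/-- On the interval `|x| < r` the function `f` is the sum of the convergent power series `F`. -/
def HasSeries (r : ℝ) (f : ℝ → ℝ) (F : PowerSeries ℝ) : Prop :=
  ∀ x, |x| < r → HasSum (fun n => PowerSeries.coeff n F * x ^ n) (f x)

namespace HasSeries

variable {r : ℝ} {f g : ℝ → ℝ} {F G : PowerSeries ℝ}

theorem congr (hf : HasSeries r f F) (h : ∀ x, |x| < r → f x = g x) : HasSeries r g F :=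
  fun x hx => h x hx ▸ hf x hx

theorem const (r c : ℝ) : HasSeries r (fun _ => c) (PowerSeries.C c) := fun x _ => by
  have h := hasSum_ite_eq (0 : ℕ) c
  refine h.congr_fun fun n => ?_
  rw [PowerSeries.coeff_C]
  split_ifs with hn <;> simp [hn]

theorem add (hf : HasSeries r f F) (hg : HasSeries r g G) :
    HasSeries r (fun x => f x + g x) (F + G) := fun x hx => by
  simpa only [map_add, add_mul] using (hf x hx).add (hg x hx)

theorem mul (hf : HasSeries r f F) (hg : HasSeries r g G) :
    HasSeries r (fun x => f x * g x) (F * G) := fun x hx => by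
  have hF := (hf x hx).summable.norm
  have hG := (hg x hx).summable.norm
  have h := (summable_norm_sum_mul_antidiagonal_of_summable_norm hF hG).of_norm.hasSum
  rw [← tsum_mul_tsum_eq_tsum_sum_antidiagonal_of_summable_norm hF hG, (hf x hx).tsum_eq,
    (hg x hx).tsum_eq] at h
  refine h.congr_fun fun n => ?_
  rw [PowerSeries.coeff_mul, sum_mul]
  refine sum_congr rfl fun y hy => ?_
  rw [← mem_antidiagonal.1 hy, pow_add]
  ring

theorem rescale {r' : ℝ} (hf : HasSeries r f F) (c : ℝ) (h : ∀ x, |x| < r' → |c * x| < r) :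
    HasSeries r' (fun x => f (c * x)) (PowerSeries.rescale c F) := fun x hx => by
  refine (hf _ (h x hx)).congr_fun fun n => ?_
  rw [PowerSeries.coeff_rescale, mul_pow]
  ring

/-- The power series of a function is determined by its values near `0`. -/
theorem unique (hr : 0 < r) (hF : HasSeries r f F) (hG : HasSeries r f G) : F = G := by
  have key : ∀ H : PowerSeries ℝ, HasSeries r f H → HasFPowerSeriesAt f
      (FormalMultilinearSeries.ofScalars ℝ fun n => PowerSeries.coeff n H) 0 := by
    intro H hH
    rw [hasFPowerSeriesAt_iff]
    filter_upwards [Metric.ball_mem_nhds (0 : ℝ) hr] with x hx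
    rw [mem_ball_zero_iff, Real.norm_eq_abs] at hx
    refine (zero_add x).symm ▸ (hH x hx).congr_fun fun n => ?_
    rw [FormalMultilinearSeries.coeff_ofScalars, smul_eq_mul, mul_comm]
  have h := (key F hF).eq_formalMultilinearSeries (key G hG)
  ext n
  simpa using congrArg (fun P => P.coeff n) h

theorem continuousOn_uIcc (hf : HasSeries r f F) {t : ℝ} (ht : |t| < r) :
    ContinuousOn f (Set.uIcc 0 t) := by
  have h : ContinuousOn (fun x => ∑' n, PowerSeries.coeff n F * x ^ n) (Set.uIcc 0 t) := by
    refine continuousOn_tsum (fun n => by fun_prop) (hf t ht).summable.norm fun n x hx => ?_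
    rw [norm_mul, norm_mul, norm_pow, norm_pow]
    gcongr
    exact abs_le_of_mem_uIcc hx
  exact h.congr fun x hx => (hf x ((abs_le_of_mem_uIcc hx).trans_lt ht)).tsum_eq.symm

/-- Termwise integration. -/
theorem integral (hg : HasSeries r g (PowerSeries.derivative ℝ F)) :
    HasSeries r (fun x => PowerSeries.constantCoeff F + ∫ z in (0 : ℝ)..x, g z) F := by
  intro t ht
  let u : ℕ → C(ℝ, ℝ) := fun n =>
    ⟨fun x => PowerSeries.coeff n (PowerSeries.derivative ℝ F) * x ^ n, by fun_prop⟩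
  have hu : Summable fun n =>
      ‖(u n).restrict (⟨Set.uIcc 0 t, isCompact_uIcc⟩ : TopologicalSpace.Compacts ℝ)‖ := by
    refine (hg t ht).summable.norm.of_nonneg_of_le (fun n => norm_nonneg _) fun n => ?_
    rw [ContinuousMap.norm_le _ (norm_nonneg _)]
    rintro ⟨x, hx⟩
    change ‖PowerSeries.coeff n (PowerSeries.derivative ℝ F) * x ^ n‖ ≤ _
    rw [norm_mul, norm_mul, norm_pow, norm_pow]
    gcongr
    exact abs_le_of_mem_uIcc hx
  have h := intervalIntegral.hasSum_intervalIntegral_of_summable_norm hu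
  have e : ∫ x in (0 : ℝ)..t, ∑' n, u n x = ∫ x in (0 : ℝ)..t, g x :=
    intervalIntegral.integral_congr fun x hx =>
      (hg x ((abs_le_of_mem_uIcc hx).trans_lt ht)).tsum_eq
  rw [e] at h
  rw [← hasSum_nat_add_iff' 1]
  simp only [range_one, sum_singleton, pow_zero, mul_one,
    PowerSeries.coeff_zero_eq_constantCoeff_apply, add_sub_cancel_left]
  refine h.congr_fun fun n => ?_
  change _ = ∫ x in (0 : ℝ)..t, PowerSeries.coeff n (PowerSeries.derivative ℝ F) * x ^ n
  rw [intervalIntegral.integral_const_mul, integral_pow, PowerSeries.coeff_derivative]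
  have : (n : ℝ) + 1 ≠ 0 := by positivity
  field_simp
  simp

/-- An antiderivative of a function with a power series has one, too. -/
theorem exists_integral (hg : HasSeries r g G) :
    ∃ H, HasSeries r (fun x => ∫ z in (0 : ℝ)..x, g z) H := by
  obtain ⟨H, hH, h0⟩ := exists_derivative_eq G 0
  refine ⟨H, (integral (hH.symm ▸ hg)).congr fun x _ => ?_⟩
  rw [h0, zero_add]

/-- The power series of the derivative is the formal derivative. -/
theorem derivative_eq (hr : 0 < r) (hf : HasSeries r f F) (hg : HasSeries r g G)
    (hd : ∀ x, |x| < r → HasDerivAt f (g x) x) : PowerSeries.derivative ℝ F = G := by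
  -- The fundamental theorem of calculus identifies `f` with the termwise integral of `G`.
  obtain ⟨H, hH, h0⟩ := exists_derivative_eq G (f 0)
  have hfH : HasSeries r f H := (integral (hH.symm ▸ hg)).congr fun t ht => by
    rw [intervalIntegral.integral_eq_sub_of_hasDerivAt
      (fun x hx => hd x ((abs_le_of_mem_uIcc hx).trans_lt ht))
      (hg.continuousOn_uIcc ht).intervalIntegrable, h0]
    ring
  rw [unique hr hf hfH, hH]

theorem constantCoeff_eq (hr : 0 < r) (hf : HasSeries r f F) :
    PowerSeries.constantCoeff F = f 0 := by
  have h := hf 0 (by simpa using hr)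
  have h' := hasSum_single (f := fun n => PowerSeries.coeff n F * (0 : ℝ) ^ n) 0
    fun n hn => by simp [hn]
  simpa using h'.unique h

/-- If `f` has some power series and solves the linear differential equation that determines the
formal power series `Y`, then `Y` is the power series of `f`. -/
theorem of_derivative_eq {τ : ℝ → ℝ} {T Y : PowerSeries ℝ} {c : ℝ} (hr : 0 < r)
    (hf : ∃ F, HasSeries r f F) (hτ : HasSeries r τ T)
    (hd : ∀ x, |x| < r → HasDerivAt f (c + f x * τ x) x)
    (hY : PowerSeries.derivative ℝ Y = PowerSeries.C c + Y * T)
    (h0 : PowerSeries.constantCoeff Y = f 0) : HasSeries r f Y := by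
  obtain ⟨F, hF⟩ := hf
  have hdF := derivative_eq hr hF ((const r c).add (hF.mul hτ)) hd
  rwa [← eq_of_derivative_eq hdF hY (by rw [hF.constantCoeff_eq hr, h0])]

/-- The restriction to the reals of a function that is holomorphic on a disc around `0` has a power
series on the whole diameter. -/
theorem exists_of_differentiableOn {h : ℂ → ℂ} (hh : DifferentiableOn ℂ h (Metric.ball 0 r))
    (hf : ∀ x : ℝ, |x| < r → h x = f x) : ∃ F, HasSeries r f F := by
  refine ⟨PowerSeries.mk fun n => ((n.factorial : ℂ)⁻¹ * iteratedDeriv n h 0).re, fun x hx => ?_⟩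
  have hs := Complex.hasSum_re (Complex.hasSum_taylorSeries_on_ball hh (z := (x : ℂ)) (by simpa))
  rw [hf x hx, Complex.ofReal_re] at hs
  refine hs.congr_fun fun n => ?_
  rw [PowerSeries.coeff_mk, ← Complex.re_mul_ofReal]
  congr 1
  simp only [smul_eq_mul, sub_zero, Complex.ofReal_pow]
  ring

end HasSeries

/-! ### The tangent and powers of the secant -/

theorem cos_pos_of_abs_lt {x : ℝ} (hx : |x| < Real.pi / 2) : 0 < Real.cos x :=
  Real.cos_pos_of_mem_Ioo (abs_lt.1 hx)

/-- On the disc of radius `π / 2` the real part `cos x cosh y` of the cosine is positive, so the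
principal branch of its powers is holomorphic there. -/
theorem cos_mem_slitPlane {z : ℂ} (hz : z ∈ Metric.ball (0 : ℂ) (Real.pi / 2)) :
    Complex.cos z ∈ Complex.slitPlane := by
  rw [mem_ball_zero_iff] at hz
  have h := cos_pos_of_abs_lt ((Complex.abs_re_le_norm z).trans_lt hz)
  left
  rw [Complex.cos_eq]
  have : (Complex.cos z.re * Complex.cosh z.im - Complex.sin z.re * Complex.sinh z.im * Complex.I).re
      = Real.cos z.re * Real.cosh z.im := by
    simp [← Complex.ofReal_cos, ← Complex.ofReal_cosh, ← Complex.ofReal_sin, ← Complex.ofReal_sinh]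
  rw [this]
  exact mul_pos h (Real.cosh_pos _)

theorem exists_hasSeries_tan : ∃ F, HasSeries (Real.pi / 2) Real.tan F := by
  refine HasSeries.exists_of_differentiableOn (h := Complex.tan) (fun z hz => ?_)
    fun x _ => (Complex.ofReal_tan x).symm
  exact (Complex.differentiableAt_tan.2
    (Complex.slitPlane_ne_zero (cos_mem_slitPlane hz))).differentiableWithinAt

theorem exists_hasSeries_sec_rpow (a : ℝ) :
    ∃ F, HasSeries (Real.pi / 2) (fun x => sec x ^ a) F := by
  refine HasSeries.exists_of_differentiableOn (h := fun z => Complex.cos z ^ ((-a : ℝ) : ℂ))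
    (fun z hz => ?_) fun x hx => ?_
  · exact ((Complex.differentiable_cos z).cpow (differentiableAt_const _)
      (cos_mem_slitPlane hz)).differentiableWithinAt
  · have h := cos_pos_of_abs_lt hx
    change Complex.cos x ^ ((-a : ℝ) : ℂ) = _
    rw [← Complex.ofReal_cos, ← Complex.ofReal_cpow h.le, sec, one_div, Real.inv_rpow h.le,
      Real.rpow_neg h.le]

theorem hasDerivAt_sec_rpow (p : ℝ) (hp : p ≠ 0) {x : ℝ} (hx : |p * x| < Real.pi / 2) :
    HasDerivAt (fun x => sec (p * x) ^ (1 / p)) (sec (p * x) ^ (1 / p) * Real.tan (p * x)) x := by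
  have h := cos_pos_of_abs_lt hx
  have hs : HasDerivAt (fun x => sec (p * x)) (p * (sec (p * x) * Real.tan (p * x))) x := by
    have hc : HasDerivAt (fun x => Real.cos (p * x)) (-Real.sin (p * x) * (p * 1)) x :=
      ((hasDerivAt_id' x).const_mul p).cos
    have := hc.inv h.ne'
    simp only [sec, one_div]
    refine this.congr_deriv ?_
    rw [Real.tan_eq_sin_div_cos]
    field_simp
  have hpos : 0 < sec (p * x) := one_div_pos.2 h
  refine (hs.rpow_const (p := 1 / p) (Or.inl hpos.ne')).congr_deriv ?_
  rw [Real.rpow_sub_one hpos.ne']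
  field_simp

theorem measurable_sec_mul_rpow (p a : ℝ) : Measurable fun x => sec (p * x) ^ a := by
  unfold sec; fun_prop

/-- The function `x ↦ sec (p x) ^ (1/p)`, which solves `y' = y tan (p x)`, `y 0 = 1`. -/
noncomputable def secPow (p x : ℝ) : ℝ := sec (p * x) ^ (1 / p)

/-- The function `x ↦ sec (p x) ^ (1/p) ∫₀ˣ sec (p z) ^ (-1/p) dz`, which solves
`y' = 1 + y tan (p x)`, `y 0 = 0`. -/
noncomputable def secPowIntegral (p x : ℝ) : ℝ :=
  secPow p x * ∫ z in (0 : ℝ)..x, sec (p * z) ^ (-(1 / p))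

theorem abs_mul_lt {p r x : ℝ} (hp : p ≠ 0) (hx : |x| < r / |p|) : |p * x| < r := by
  rw [abs_mul, mul_comm]
  exact (lt_div_iff₀ (abs_pos.2 hp)).1 hx

theorem exists_hasSeries_sec_mul_rpow {p : ℝ} (hp : p ≠ 0) (a : ℝ) :
    ∃ F, HasSeries (Real.pi / 2 / |p|) (fun x => sec (p * x) ^ a) F := by
  obtain ⟨F, hF⟩ := exists_hasSeries_sec_rpow a
  exact ⟨_, hF.rescale p fun x hx => abs_mul_lt hp hx⟩

theorem exists_hasSeries_secPowIntegral {p : ℝ} (hp : p ≠ 0) :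
    ∃ F, HasSeries (Real.pi / 2 / |p|) (secPowIntegral p) F := by
  obtain ⟨F, hF⟩ := exists_hasSeries_sec_mul_rpow hp (1 / p)
  obtain ⟨G, hG⟩ := exists_hasSeries_sec_mul_rpow hp (-(1 / p))
  obtain ⟨H, hH⟩ := hG.exists_integral
  exact ⟨_, hF.mul hH⟩

theorem hasDerivAt_secPowIntegral {p x : ℝ} (hp : p ≠ 0) (hx : |x| < Real.pi / 2 / |p|) :
    HasDerivAt (secPowIntegral p) (1 + secPowIntegral p x * Real.tan (p * x)) x := by
  have hpos : 0 < sec (p * x) := one_div_pos.2 (cos_pos_of_abs_lt (abs_mul_lt hp hx))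
  obtain ⟨G, hG⟩ := exists_hasSeries_sec_mul_rpow hp (-(1 / p))
  have hcont : ContinuousAt (fun z => sec (p * z) ^ (-(1 / p))) x := by
    have hc : ContinuousAt (fun z => sec (p * z)) x := by
      unfold sec
      refine ContinuousAt.div (by fun_prop) (by fun_prop) ?_
      exact (cos_pos_of_abs_lt (abs_mul_lt hp hx)).ne'
    exact hc.rpow_const (Or.inl hpos.ne')
  have hI := intervalIntegral.integral_hasDerivAt_right
    (hG.continuousOn_uIcc hx).intervalIntegrable
    (measurable_sec_mul_rpow p _).stronglyMeasurable.stronglyMeasurableAtFilter hcont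
  refine ((hasDerivAt_sec_rpow p hp (abs_mul_lt hp hx)).mul hI).congr_deriv ?_
  rw [← Real.rpow_add hpos, add_neg_cancel, Real.rpow_zero, secPowIntegral, secPow]
  ring

/-! ### Identification of the generating functions -/

/-- Up-down permutations of odd length are counted by the tangent, which solves the same equation
`y' = 1 + y²`. -/
theorem hasSeries_tan : HasSeries (Real.pi / 2) Real.tan (altSeries true true 1 1) := by
  have hpi : 0 < Real.pi / 2 := by positivity
  obtain ⟨F, hF⟩ := exists_hasSeries_tan
  have hdF := hF.derivative_eq hpi ((HasSeries.const _ 1).add (hF.mul hF)) fun x hx => by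
    have h := (cos_pos_of_abs_lt hx).ne'
    refine (Real.hasDerivAt_tan h).congr_deriv ?_
    rw [Real.tan_eq_sin_div_cos]
    field_simp
    linarith [Real.sin_sq_add_cos_sq x]
  have hdT := derivative_altSeries true true 1 1
  simp only [PowerSeries.rescale_one, RingHom.id_apply, Bool.and_self, if_true, Bool.not_true,
    Bool.false_xor] at hdT
  -- The difference of two solutions of `y' = 1 + y²` solves a linear equation.
  have h0 : F - altSeries true true 1 1 = 0 := by
    refine eq_of_derivative_eq (T := F + altSeries true true 1 1) (c := 0) ?_ (by simp) ?_
    · rw [map_sub, hdF, hdT, map_zero]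
      ring
    · rw [map_sub, hF.constantCoeff_eq hpi, constantCoeff_altSeries]
      simp
  rwa [← sub_eq_zero.1 h0]

section Marginals

variable {p : ℝ} (hp : p ≠ 0)
include hp

theorem hasSeries_tan_mul :
    HasSeries (Real.pi / 2 / |p|) (fun x => Real.tan (p * x))
      (PowerSeries.rescale p (altSeries true true 1 1)) :=
  hasSeries_tan.rescale p fun _ hx => abs_mul_lt hp hx

theorem hasSeries_secPow {Y : PowerSeries ℝ}
    (hY : PowerSeries.derivative ℝ Y =
      PowerSeries.C 0 + Y * PowerSeries.rescale p (altSeries true true 1 1))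
    (h0 : PowerSeries.constantCoeff Y = 1) : HasSeries (Real.pi / 2 / |p|) (secPow p) Y := by
  refine HasSeries.of_derivative_eq (by positivity) (exists_hasSeries_sec_mul_rpow hp (1 / p))
    (hasSeries_tan_mul hp) (fun x hx => ?_) hY (by simp [h0, secPow, sec])
  exact (hasDerivAt_sec_rpow p hp (abs_mul_lt hp hx)).congr_deriv (zero_add _).symm

theorem hasSeries_secPowIntegral {Y : PowerSeries ℝ}
    (hY : PowerSeries.derivative ℝ Y =
      PowerSeries.C 1 + Y * PowerSeries.rescale p (altSeries true true 1 1))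
    (h0 : PowerSeries.constantCoeff Y = 0) :
    HasSeries (Real.pi / 2 / |p|) (secPowIntegral p) Y :=
  HasSeries.of_derivative_eq (by positivity) (exists_hasSeries_secPowIntegral hp)
    (hasSeries_tan_mul hp) (fun _ hx => hasDerivAt_secPowIntegral hp hx) hY
    (by simp [h0, secPowIntegral])

theorem hasSeries_upDown_odd_left :
    HasSeries (Real.pi / 2 / |p|) (secPowIntegral p) (altSeries true true p 1) :=
  hasSeries_secPowIntegral hp (by simpa using derivative_altSeries true true p 1)
    (by simp [constantCoeff_altSeries])

theorem hasSeries_upDown_odd_right :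
    HasSeries (Real.pi / 2 / |p|) (secPowIntegral p) (altSeries true true 1 p) :=
  hasSeries_secPowIntegral hp (by simpa [mul_comm] using derivative_altSeries true true 1 p)
    (by simp [constantCoeff_altSeries])

theorem hasSeries_downUp_even_left :
    HasSeries (Real.pi / 2 / |p|) (secPow p) (altSeries false false p 1) :=
  hasSeries_secPow hp (by simpa using derivative_altSeries false false p 1)
    (by simp [constantCoeff_altSeries])

theorem hasSeries_upDown_even_right :
    HasSeries (Real.pi / 2 / |p|) (secPow p) (altSeries true false 1 p) :=
  hasSeries_secPow hp (by simpa [mul_comm] using derivative_altSeries true false 1 p)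
    (by simp [constantCoeff_altSeries])

end Marginals

/-- Both functions on the two sides of the largest letter have their power series at `q s` and `p s`
as long as `|p q s| < π / 2`. -/
theorem HasSeries.rescale_mul_rescale {p q : ℝ} (hp : p ≠ 0) (hq : q ≠ 0) {f g : ℝ → ℝ}
    {F G : PowerSeries ℝ} (hf : HasSeries (Real.pi / 2 / |p|) f F)
    (hg : HasSeries (Real.pi / 2 / |q|) g G) :
    HasSeries (Real.pi / 2 / |p * q|) (fun s => f (q * s) * g (p * s))
      (PowerSeries.rescale q F * PowerSeries.rescale p G) := by
  refine (hf.rescale q fun x hx => abs_mul_lt hq ?_).mul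
    (hg.rescale p fun x hx => abs_mul_lt hp ?_)
  · rwa [div_div, ← abs_mul]
  · rwa [div_div, ← abs_mul, mul_comm q p]

/-- Integrating `derivative_altSeries`: the generating function is the integral of the product of the
generating functions `f` and `g` of the words to the left and to the right of the largest letter. -/
theorem hasSum_altSeries {p q : ℝ} (hp : p ≠ 0) (hq : q ≠ 0) (b e : Bool) {f g : ℝ → ℝ}
    (hf : HasSeries (Real.pi / 2 / |p|) f (altSeries b b p 1))
    (hg : HasSeries (Real.pi / 2 / |q|) g (altSeries true ((!e) ^^ b) 1 q)) {t : ℝ}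
    (ht : |p * q * t| < Real.pi / 2) :
    HasSum (fun n => PowerSeries.coeff n (altSeries b e p q) * t ^ n)
      ((if e then 0 else 1) +
        ∫ s in (0 : ℝ)..t, ((if b && e then 1 else 0) + f (q * s) * g (p * s))) := by
  have h := (HasSeries.const _ (if b && e then 1 else 0)).add (hf.rescale_mul_rescale hp hq hg)
  rw [← derivative_altSeries] at h
  rw [← constantCoeff_altSeries b e p q]
  refine h.integral t ?_
  rwa [lt_div_iff₀ (abs_pos.2 (mul_ne_zero hp hq)), mul_comm, ← abs_mul]

theorem hasSum_egfTerm_odd {b : Bool} {S : (m : ℕ) → Finset (Equiv.Perm (Fin m))}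
    (hS : ∀ m (π : Equiv.Perm (Fin m)), π ∈ S m ↔ IsAlt b (List.ofFn π)) {p q t v : ℝ}
    (h : HasSum (fun n => PowerSeries.coeff n (altSeries b true p q) * t ^ n) v) :
    HasSum (fun n : ℕ => egfTerm S t p q (2 * n + 1)) v := by
  have hinj : Function.Injective fun n : ℕ => 2 * n + 1 := fun a b hab => by
    simpa using hab
  rw [← hinj.hasSum_iff] at h
  · refine h.congr_fun fun n => ?_
    rw [egfTerm, jointPoly_eq_altSum b _ (hS _), Function.comp_apply, altSeries,
      PowerSeries.coeff_mk, if_pos (by simp [bodd_eq_decide_odd]), altCoeff]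
    ring
  · intro n hn
    rw [altSeries, PowerSeries.coeff_mk, if_neg, zero_mul]
    intro hodd
    rw [bodd_eq_decide_odd, decide_eq_true_eq] at hodd
    obtain ⟨k, rfl⟩ := hodd
    exact hn ⟨k, rfl⟩

/-- The summand `1` is the term of the empty permutation. -/
theorem hasSum_egfTerm_even {b : Bool} {S : (m : ℕ) → Finset (Equiv.Perm (Fin m))}
    (hS : ∀ m (π : Equiv.Perm (Fin m)), π ∈ S m ↔ IsAlt b (List.ofFn π)) {p q t v : ℝ}
    (h : HasSum (fun n => PowerSeries.coeff n (altSeries b false p q) * t ^ n) (1 + v)) :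
    HasSum (fun n : ℕ => egfTerm S t p q (2 * (n + 1))) v := by
  have hinj : Function.Injective fun n : ℕ => 2 * n := fun a b hab => by
    simpa using hab
  rw [← hinj.hasSum_iff, ← hasSum_nat_add_iff' 1] at h
  · have h0 := constantCoeff_altSeries b false p q
    rw [← PowerSeries.coeff_zero_eq_constantCoeff_apply] at h0
    simp only [range_one, sum_singleton, Function.comp_apply, mul_zero, h0, Bool.false_eq_true,
      if_false, pow_zero, mul_one, add_sub_cancel_left] at h
    refine h.congr_fun fun n => ?_
    rw [egfTerm, jointPoly_eq_altSum b _ (hS _), altSeries,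
      PowerSeries.coeff_mk, if_pos (by simp [bodd_eq_decide_odd]), altCoeff]
    ring
  · intro n hn
    rw [altSeries, PowerSeries.coeff_mk, if_neg, zero_mul]
    intro heven
    rw [bodd_eq_decide_odd, decide_eq_false_iff_not, Nat.not_odd_iff_even] at heven
    obtain ⟨k, rfl⟩ := heven
    exact hn ⟨k, two_mul k⟩

theorem secPow_mul_secPow {p q s : ℝ} (hs : |p * q * s| < Real.pi / 2) :
    secPow p (q * s) * secPow q (p * s) = sec (p * q * s) ^ (1 / p + 1 / q) := by
  have hpos : 0 < sec (p * q * s) := one_div_pos.2 (cos_pos_of_abs_lt hs)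
  rw [Real.rpow_add hpos, secPow, secPow, ← mul_assoc, ← mul_assoc, mul_comm q p]

theorem abs_mul_lt_of_mem_uIcc {c r s t : ℝ} (ht : |c * t| < r) (hs : s ∈ Set.uIcc 0 t) :
    |c * s| < r := by
  rw [abs_mul] at ht ⊢
  exact (mul_le_mul_of_nonneg_left (abs_le_of_mem_uIcc hs) (abs_nonneg c)).trans_lt ht

end AltPerm

open AltPerm

theorem mainTheorem4 (p q t : ℝ) (hp : p ≠ 0) (hq : q ≠ 0) (ht : |p * q * t| < Real.pi / 2) :
    (Summable (fun n : ℕ => AltPerm.egfTerm AltPerm.UD t p q (2 * (n + 1))) ∧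
      AltPerm.genA t p q = 1 + ∫ s in (0 : ℝ)..t,
        AltPerm.sec (p * q * s) ^ (1 / p + 1 / q) *
          ∫ z in (0 : ℝ)..(q * s), AltPerm.sec (p * z) ^ (-(1 / p))) ∧
    (Summable (fun n : ℕ => AltPerm.egfTerm AltPerm.UD t p q (2 * n + 1)) ∧
      AltPerm.genB t p q = t + ∫ s in (0 : ℝ)..t,
        AltPerm.sec (p * q * s) ^ (1 / p + 1 / q) *
          (∫ z in (0 : ℝ)..(q * s), AltPerm.sec (p * z) ^ (-(1 / p))) *
          (∫ z in (0 : ℝ)..(p * s), AltPerm.sec (q * z) ^ (-(1 / q)))) ∧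
    (Summable (fun n : ℕ => AltPerm.egfTerm AltPerm.DU t p q (2 * (n + 1))) ∧
      AltPerm.genC t p q = 1 + ∫ s in (0 : ℝ)..t,
        AltPerm.sec (p * q * s) ^ (1 / p + 1 / q) *
          ∫ z in (0 : ℝ)..(p * s), AltPerm.sec (q * z) ^ (-(1 / q))) ∧
    (Summable (fun n : ℕ => AltPerm.egfTerm AltPerm.DU t p q (2 * n + 1)) ∧
      AltPerm.genD t p q = ∫ z in (0 : ℝ)..t, AltPerm.sec (p * q * z) ^ (1 / p + 1 / q)) := by
  have hmul : ∀ s ∈ Set.uIcc 0 t,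
      sec (p * q * s) ^ (1 / p + 1 / q) = secPow p (q * s) * secPow q (p * s) :=
    fun s hs => (secPow_mul_secPow (abs_mul_lt_of_mem_uIcc ht hs)).symm
  have hA := hasSum_egfTerm_even (fun m => mem_UD_iff) (hasSum_altSeries hp hq true false
    (hasSeries_upDown_odd_left hp) (hasSeries_upDown_even_right hq) ht)
  have hB := hasSum_egfTerm_odd (fun m => mem_UD_iff) (hasSum_altSeries hp hq true true
    (hasSeries_upDown_odd_left hp) (hasSeries_upDown_odd_right hq) ht)
  have hC := hasSum_egfTerm_even (fun m => mem_DU_iff) (hasSum_altSeries hp hq false false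
    (hasSeries_downUp_even_left hp) (hasSeries_upDown_odd_right hq) ht)
  have hD := hasSum_egfTerm_odd (fun m => mem_DU_iff) (hasSum_altSeries hp hq false true
    (hasSeries_downUp_even_left hp) (hasSeries_upDown_even_right hq) ht)
  refine ⟨⟨hA.summable, ?_⟩, ⟨hB.summable, ?_⟩, ⟨hC.summable, ?_⟩, ⟨hD.summable, ?_⟩⟩
  · rw [genA, hA.tsum_eq]
    congr 1
    refine intervalIntegral.integral_congr fun s hs => ?_
    simp only [hmul s hs, secPowIntegral, Bool.and_false, Bool.false_eq_true, if_false]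
    ring
  · have hint : IntervalIntegrable (fun s => secPowIntegral p (q * s) * secPowIntegral q (p * s))
        MeasureTheory.volume 0 t := by
      refine (((hasSeries_upDown_odd_left hp).rescale_mul_rescale hp hq
        (hasSeries_upDown_odd_right hq)).continuousOn_uIcc ?_).intervalIntegrable
      rwa [lt_div_iff₀ (abs_pos.2 (mul_ne_zero hp hq)), mul_comm, ← abs_mul]
    simp only [Bool.and_self, if_true, zero_add] at hB
    rw [intervalIntegral.integral_add (by simp) hint] at hB
    rw [genB, hB.tsum_eq]
    simp only [intervalIntegral.integral_const, sub_zero, smul_eq_mul, mul_one]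
    congr 1
    refine intervalIntegral.integral_congr fun s hs => ?_
    simp only [hmul s hs, secPowIntegral]
    ring
  · rw [genC, hC.tsum_eq]
    congr 1
    refine intervalIntegral.integral_congr fun s hs => ?_
    simp only [hmul s hs, secPowIntegral, Bool.and_false, Bool.false_eq_true, if_false]
    ring
  · rw [genD, hD.tsum_eq]
    simp only [if_true, zero_add]
    refine intervalIntegral.integral_congr fun s hs => ?_
    simp only [hmul s hs, Bool.false_and, Bool.false_eq_true, if_false]
    ring
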